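/- Let $d, n \ge 0$ be integers, let $U \subseteq \mathbb{R}^d$ be open, and let $a_0, \dots, a_n : U \to \mathbb{R}$ be continuous functions such that $(a_0(h), \dots, a_n(h)) \neq (0, \dots, 0)$ for at least one $h \in U$. Let $f : \mathbb{R}^d \to \mathbb{R}$ be a continuous function satisfying $$a_0(h) f(x) + a_1(h) f(x+h) + \cdots + a_n(h) f(x+nh) = 0 \quad \text{for all } x \in \mathbb{R}^d \text{ and all } h \in U.$$ Then $f$ is an exponential polynomial in $d$ variables, that is, a finite linear combination with complex coefficients of exponential monomials $x \mapsto x^{\alpha} e^{\langle x, \lambda\rangle}$ with $\alpha \in \mathbb{N}^d$ and $\lambda \in \mathbb{C}^d$, where $x^\alpha = \prod_{i=1}^d x_i^{\alpha_i}$ and $\langle x, \lambda\rangle = \sum_{i=1}^d x_i \lambda_i$. -/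

import Mathlib

/-- The exponential monomial `x ↦ x^α * exp ⟨x, l⟩` on `ℝ^d`, with multi-index `α ∈ ℕ^d` and
frequency vector `l ∈ ℂ^d`; the pairing `⟨x, l⟩ = ∑ i, x i * l i` is bilinear. -/
noncomputable def expMonomial {d : ℕ} (α : Fin d → ℕ) (l : Fin d → ℂ) :
    EuclideanSpace ℝ (Fin d) → ℂ :=
  fun x => (∏ i, (x i : ℂ) ^ α i) * Complex.exp (∑ i, (x i : ℂ) * l i)

/-- An exponential polynomial in `d` variables: a finite complex linear combination of
exponential monomials. -/
def IsExponentialPolynomial {d : ℕ} (g : EuclideanSpace ℝ (Fin d) → ℂ) : Prop :=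
  g ∈ Submodule.span ℂ
    (Set.range fun p : (Fin d → ℕ) × (Fin d → ℂ) => expMonomial p.1 p.2)

/-!
The continuous complex solutions of the functional equation form a translation-invariant subspace
`V` of `E → ℂ`. The proof shows that `V` is finite-dimensional, and then that every
finite-dimensional translation-invariant space of smooth functions consists of exponential
polynomials.

Finite-dimensionality rests on two uniform estimates. The set of steps `h` at which some fixed
coefficient is nonzero is open and nonempty, so it contains a basis of `E`; along each basis vector
the equation is a nontrivial constant-coefficient recurrence, which extrapolates in both directions,
so a solution is controlled on any ball by its supremum on one fixed ball
(`exists_forall_norm_le_closedBall`). On the other hand, integrating the equation in `h` against a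
suitable weight expresses a solution through averages of itself (`exists_average_eq`), which makes
the solutions equicontinuous relative to their supremum on a larger ball
(`eventually_norm_average_sub_le`). Together, a solution vanishing on a fine enough finite net of
the fixed ball is bounded there by half of its own supremum, so it is zero: evaluation on the net is
injective on `V` (`finiteDimensional_solutionSpace`).

Being finite-dimensional, `V` is closed under pointwise limits. Mollification therefore shows that
its members are smooth (`contDiff_of_mem_solutionSpace`), and difference quotients show that the
partial derivatives act on `V`. They commute, so `V` is the sum of their joint generalized eigenspaces. If
`g` lies in the one with eigenvalues `χ`, then `∂ₓ - ⟨x, χ⟩` is nilpotent on `g` for every `x`, and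
Taylor's formula along the segment from `0` to `x` for `t ↦ exp (-t ⟨x, χ⟩) * g (t • x)` is a finite
exact expression: `exp ⟨x, χ⟩` times a polynomial in `x`
(`isExponentialPolynomial_of_translation_invariant`).
-/

open Metric Set Filter Topology MeasureTheory
open scoped ContDiff

/-! ### Extrapolation by recurrences -/

/-- If `c m ≠ 0`, the recurrence bounds `G t` by the values of `G` at the other points
`t - m + k` of the pattern for which the coefficient `c k` is nonzero. -/
theorem norm_le_of_recurrence {n : ℕ} {c : Fin (n + 1) → ℂ} {G : ℝ → ℂ}
    (hG : ∀ t : ℝ, ∑ k, c k * G (t + (k : ℕ)) = 0) {m : Fin (n + 1)} (hm : c m ≠ 0) {t M : ℝ}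
    (h : ∀ k, k ≠ m → c k ≠ 0 → ‖G (t - (m : ℕ) + (k : ℕ))‖ ≤ M) (hM : 0 ≤ M) :
    ‖G t‖ ≤ (∑ k, ‖c k‖) / ‖c m‖ * M := by
  have h0 := hG (t - (m : ℕ))
  rw [← Finset.add_sum_erase _ _ (Finset.mem_univ m), sub_add_cancel] at h0
  have h1 : ‖c m‖ * ‖G t‖ ≤ (∑ k, ‖c k‖) * M := by
    rw [← norm_mul, eq_neg_of_add_eq_zero_left h0, norm_neg, Finset.sum_mul]
    refine (norm_sum_le _ _).trans ((Finset.sum_le_sum fun k hk => ?_).trans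
      (Finset.sum_le_sum_of_subset_of_nonneg (Finset.erase_subset _ _) fun k _ _ => by positivity))
    rw [norm_mul]
    by_cases hk0 : c k = 0
    · simp [hk0]
    · exact mul_le_mul_of_nonneg_left (h k (Finset.ne_of_mem_erase hk) hk0) (norm_nonneg _)
  rw [div_mul_eq_mul_div, le_div_iff₀ (norm_pos_iff.2 hm)]
  linarith

/-- A function on the line obeying a nontrivial constant-coefficient recurrence is controlled on
`[-(r + 1), r + 1]` by its size on `[-r, r]`: the highest nonzero coefficient extrapolates to the
right and the lowest one to the left. -/
theorem exists_forall_norm_le_of_recurrence {n : ℕ} {c : Fin (n + 1) → ℂ} (hc : ∃ k, c k ≠ 0) :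
    ∃ C : ℝ, 0 ≤ C ∧ ∀ G : ℝ → ℂ, (∀ t : ℝ, ∑ k, c k * G (t + (k : ℕ)) = 0) →
      ∀ r : ℝ, n ≤ r → ∀ M : ℝ, (∀ t, |t| ≤ r → ‖G t‖ ≤ M) → ∀ t, |t| ≤ r + 1 →
        ‖G t‖ ≤ C * M := by
  classical
  have hne : (Finset.univ.filter fun k => c k ≠ 0).Nonempty := by
    obtain ⟨k, hk⟩ := hc
    exact ⟨k, by simpa using hk⟩
  obtain ⟨p, hp, hpm⟩ := Finset.exists_max_image _ id hne
  obtain ⟨q, hq, hqm⟩ := Finset.exists_min_image _ id hne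
  simp only [Finset.mem_filter, Finset.mem_univ, true_and, id] at hp hpm hq hqm
  set A := (∑ k, ‖c k‖) / ‖c p‖
  set B := (∑ k, ‖c k‖) / ‖c q‖
  have hA : 0 ≤ A := by positivity
  have hB : 0 ≤ B := by positivity
  refine ⟨1 + A + B, by positivity, fun G hG r hr M hM t ht => ?_⟩
  have hr0 : 0 ≤ r := (Nat.cast_nonneg n).trans hr
  have hM0 : 0 ≤ M := (norm_nonneg _).trans (hM 0 (by simpa using hr0))
  have hAM := mul_nonneg hA hM0
  have hBM := mul_nonneg hB hM0
  have hle : ∀ k : Fin (n + 1), ((k : ℕ) : ℝ) ≤ n := fun k => by exact_mod_cast Fin.is_le k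
  rw [abs_le] at ht
  have lt_cast : ∀ {i j : Fin (n + 1)}, i ≤ j → i ≠ j → ((i : ℕ) : ℝ) + 1 ≤ (j : ℕ) := by
    intro i j h1 h2
    exact_mod_cast lt_of_le_of_ne h1 h2
  rcases lt_or_ge r t with h1 | h1
  · have := norm_le_of_recurrence hG hp (t := t) (fun k hk hk0 => hM _ ?_) hM0
    · linarith
    · have := lt_cast (hpm k hk0) hk
      have := hle p
      have : (0 : ℝ) ≤ (k : ℕ) := Nat.cast_nonneg _
      rw [abs_le]
      constructor <;> linarith
  rcases lt_or_ge t (-r) with h2 | h2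
  · have := norm_le_of_recurrence hG hq (t := t) (fun k hk hk0 => hM _ ?_) hM0
    · linarith
    · have := lt_cast (hqm k hk0) hk.symm
      have := hle k
      have : (0 : ℝ) ≤ (q : ℕ) := Nat.cast_nonneg _
      rw [abs_le]
      constructor <;> linarith
  · have := hM t (abs_le.2 ⟨h2, h1⟩)
    linarith

section Extrapolation

variable {E : Type*} [NormedAddCommGroup E] [NormedSpace ℝ E] {n : ℕ}

/-- The multidimensional form of `exists_forall_norm_le_of_recurrence`, for boxes in the coordinates
of a basis `b` whose vectors are the steps of the recurrences. The constant does not depend on the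
size of the box. -/
theorem exists_forall_norm_le_box_add_one {ι : Type*} [Fintype ι] (b : Module.Basis ι ℝ E)
    {c : ι → Fin (n + 1) → ℂ} (hc : ∀ i, ∃ k, c i k ≠ 0) :
    ∃ C : ℝ, 0 ≤ C ∧ ∀ g : E → ℂ,
      (∀ i x, ∑ k, c i k * g (x + ((k : ℕ) : ℝ) • b i) = 0) →
      ∀ r : ℝ, n ≤ r → ∀ M : ℝ, (∀ x, (∀ i, |b.repr x i| ≤ r) → ‖g x‖ ≤ M) →
        ∀ x, (∀ i, |b.repr x i| ≤ r + 1) → ‖g x‖ ≤ C * M := by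
  classical
  -- The box is enlarged in one coordinate direction at a time.
  suffices H : ∀ S : Finset ι, ∃ C : ℝ, 0 ≤ C ∧ ∀ g : E → ℂ,
      (∀ i x, ∑ k, c i k * g (x + ((k : ℕ) : ℝ) • b i) = 0) →
      ∀ r : ℝ, n ≤ r → ∀ M : ℝ, (∀ x, (∀ i, |b.repr x i| ≤ r) → ‖g x‖ ≤ M) →
        ∀ x, (∀ i, |b.repr x i| ≤ r + if i ∈ S then 1 else 0) → ‖g x‖ ≤ C * M by
    simpa using H Finset.univ
  intro S
  induction S using Finset.induction_on with
  | empty =>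
    exact ⟨1, zero_le_one, fun g _ r _ M hM x hx => by simpa using hM x (by simpa using hx)⟩
  | insert i S hi ih =>
    obtain ⟨C, hC, hS⟩ := ih
    obtain ⟨C', hC', hi'⟩ := exists_forall_norm_le_of_recurrence (hc i)
    refine ⟨C' * C, by positivity, fun g hg r hr M hM x hx => ?_⟩
    have hline : ∀ t : ℝ, |t| ≤ r → ‖g (x + (t - b.repr x i) • b i)‖ ≤ C * M := by
      intro t ht
      refine hS g hg r hr M hM _ fun j => ?_
      by_cases hj : j = i
      · subst hj
        simpa [hi] using ht
      · have := hx j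
        simp only [Finset.mem_insert, hj, false_or] at this
        simpa [Finsupp.single_apply, Ne.symm hj] using this
    have := hi' (fun t => g (x + (t - b.repr x i) • b i)) (fun t => ?_) r hr (C * M) hline
      (b.repr x i) (by simpa using hx i)
    · simpa [mul_assoc] using this
    · rw [← hg i (x + (t - b.repr x i) • b i)]
      refine Finset.sum_congr rfl fun k _ => ?_
      congr 2
      module

/-- If the directions of finitely many nontrivial recurrences form a basis, the solutions are
controlled on every ball by their size on one fixed ball. -/
theorem exists_forall_norm_le_closedBall [FiniteDimensional ℝ E] {ι : Type*} [Fintype ι]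
    (b : Module.Basis ι ℝ E) {c : ι → Fin (n + 1) → ℂ} (hc : ∀ i, ∃ k, c i k ≠ 0) :
    ∃ R₀ : ℝ, 0 ≤ R₀ ∧ ∀ R : ℝ, ∃ C : ℝ, 0 ≤ C ∧ ∀ g : E → ℂ,
      (∀ i x, ∑ k, c i k * g (x + ((k : ℕ) : ℝ) • b i) = 0) →
      ∀ M : ℝ, (∀ x, ‖x‖ ≤ R₀ → ‖g x‖ ≤ M) → ∀ x, ‖x‖ ≤ R → ‖g x‖ ≤ C * M := by
  obtain ⟨C, hC, H⟩ := exists_forall_norm_le_box_add_one b hc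
  have key : ∀ N : ℕ, ∀ g : E → ℂ,
      (∀ i x, ∑ k, c i k * g (x + ((k : ℕ) : ℝ) • b i) = 0) →
      ∀ M : ℝ, (∀ x, (∀ i, |b.repr x i| ≤ n) → ‖g x‖ ≤ M) →
        ∀ x, (∀ i, |b.repr x i| ≤ n + N) → ‖g x‖ ≤ C ^ N * M := by
    intro N
    induction N with
    | zero => intro g _ M hM x hx; simpa using hM x (by simpa using hx)
    | succ N ih =>
      intro g hg M hM x hx
      have := H g hg (n + N) (by simp) _ (ih g hg M hM) x (by simpa [add_assoc] using hx)
      rwa [pow_succ', mul_assoc]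
  refine ⟨∑ i, n * ‖b i‖, by positivity, fun R => ?_⟩
  let L : E →L[ℝ] (ι → ℝ) := LinearMap.toContinuousLinearMap b.equivFun.toLinearMap
  obtain ⟨N, hN⟩ := exists_nat_ge (‖L‖ * R)
  refine ⟨C ^ N, by positivity, fun g hg M hM x hx => key N g hg M (fun y hy => hM y ?_) x ?_⟩
  · rw [← b.sum_repr y]
    refine (norm_sum_le _ _).trans (Finset.sum_le_sum fun i _ => ?_)
    rw [norm_smul]
    exact mul_le_mul_of_nonneg_right (hy i) (norm_nonneg _)
  · intro i
    have h1 : ‖L x i‖ ≤ ‖L‖ * ‖x‖ := (norm_le_pi_norm (L x) i).trans (L.le_opNorm x)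
    have h2 : ‖L‖ * ‖x‖ ≤ ‖L‖ * R := mul_le_mul_of_nonneg_left hx (norm_nonneg _)
    have h3 : L x i = b.repr x i := rfl
    rw [← h3, ← Real.norm_eq_abs]
    have : (0 : ℝ) ≤ n := Nat.cast_nonneg _
    linarith

end Extrapolation

/-! ### Equicontinuity of averages -/

section Averaging

variable {E : Type*} [NormedAddCommGroup E] [NormedSpace ℝ E] [FiniteDimensional ℝ E]
  [MeasurableSpace E] [BorelSpace E] {μ : Measure E} [μ.IsAddHaarMeasure]

/-- The averages `x ↦ ∫ h, ψ h * g (x + s • h)` are equicontinuous on a ball, uniformly in all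
continuous `g` bounded by `M` on a suitable larger ball. The increment in `x` is moved
onto `ψ` by translating the integration variable. -/
theorem eventually_norm_average_sub_le {ψ : E → ℂ} (hψ : Continuous ψ) (hψs : HasCompactSupport ψ)
    {s : ℝ} (hs : s ≠ 0) (R : ℝ) :
    ∀ᶠ R' : ℝ in atTop, ∀ ε > 0, ∀ᶠ δ in 𝓝[>] (0 : ℝ), ∀ g : E → ℂ, Continuous g → ∀ M : ℝ,
      0 ≤ M → (∀ x, ‖x‖ ≤ R' → ‖g x‖ ≤ M) → ∀ x y, ‖x‖ ≤ R → dist x y < δ →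
        ‖(∫ h, ψ h * g (x + s • h) ∂μ) - ∫ h, ψ h * g (y + s • h) ∂μ‖ ≤ ε * M := by
  obtain ⟨ρ, hρ⟩ := hψs.isCompact.isBounded.subset_closedBall (0 : E)
  have hzero : ∀ h, ρ < ‖h‖ → ψ h = 0 := fun h hh => by
    by_contra hne
    have := hρ (subset_tsupport _ (Function.mem_support.2 hne))
    rw [mem_closedBall_zero_iff] at this
    linarith
  filter_upwards [eventually_ge_atTop (R + |s| * (ρ + 1))] with R' hR' ε hε
  set K := closedBall (0 : E) (ρ + 1)
  have hKfin : μ K < ⊤ := (isCompact_closedBall _ _).measure_lt_top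
  have hε' : 0 < ε / (μ.real K + 1) := by positivity
  obtain ⟨η, hη, hunif⟩ := Metric.uniformContinuous_iff.1
    (hψs.uniformContinuous_of_continuous hψ) _ hε'
  have hs' : 0 < |s| := abs_pos.2 hs
  filter_upwards [Ioo_mem_nhdsGT (show 0 < |s| * min η 1 by positivity)]
    with δ hδ g hg M hM0 hM x y hx hxy
  -- Replacing `h` by `h + v` turns `y + s • h` into `x + s • h`.
  set v := s⁻¹ • (x - y)
  have hv : ‖v‖ < min η 1 := by
    rw [norm_smul, norm_inv, Real.norm_eq_abs, inv_mul_lt_iff₀ hs', ← dist_eq_norm]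
    exact hxy.trans hδ.2
  have hshift : ∫ h, ψ h * g (y + s • h) ∂μ = ∫ h, ψ (h + v) * g (x + s • h) ∂μ := by
    rw [← integral_add_right_eq_self _ v]
    refine integral_congr_ae (Eventually.of_forall fun h => ?_)
    have : s • v = x - y := smul_inv_smul₀ hs _
    simp only [smul_add, this]
    congr 2
    abel
  have hint : ∀ w : E, Integrable (fun h => ψ (h + w) * g (x + s • h)) μ := fun w =>
    Continuous.integrable_of_hasCompactSupport (by fun_prop)
      ((hψs.comp_homeomorph (Homeomorph.addRight w)).mul_right)
  have h0 := hint 0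
  simp only [add_zero] at h0
  rw [hshift, ← integral_sub h0 (hint v),
    ← setIntegral_eq_integral_of_forall_compl_eq_zero (s := K)]
  · refine (norm_setIntegral_le_of_norm_le_const (C := ε / (μ.real K + 1) * M) hKfin
      fun h hh => ?_).trans ?_
    · rw [← sub_mul, norm_mul]
      refine mul_le_mul ?_ (hM _ ?_) (norm_nonneg _) hε'.le
      · rw [← dist_eq_norm]
        refine (hunif ?_).le
        rw [dist_eq_norm, sub_add_cancel_left, norm_neg]
        exact hv.trans_le (min_le_left _ _)
      · rw [mem_closedBall_zero_iff] at hh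
        refine (norm_add_le _ _).trans (le_trans ?_ hR')
        rw [norm_smul, Real.norm_eq_abs]
        gcongr
    · have : μ.real K / (μ.real K + 1) ≤ 1 := by
        rw [div_le_one (by positivity)]
        linarith
      calc _ = ε * M * (μ.real K / (μ.real K + 1)) := by ring
        _ ≤ ε * M * 1 := by gcongr
        _ = _ := mul_one _
  · intro h hh
    rw [mem_closedBall_zero_iff, not_le] at hh
    have h1 : ‖h‖ ≤ ‖h + v‖ + ‖v‖ := norm_le_add_norm_add h v
    have h2 : ‖v‖ < 1 := hv.trans_le (min_le_right _ _)
    rw [hzero h (by linarith), hzero (h + v) (by linarith), sub_self]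

end Averaging

/-! ### Finite-dimensionality of the solution space -/

section SolutionSpace

variable {E : Type*} [NormedAddCommGroup E] [NormedSpace ℝ E] {n : ℕ}

/-- The continuous complex-valued solutions `g` of the functional equation
`∑ k, A k h * g (x + k • h) = 0` for all `x` and all `h ∈ U`, as a subspace of `E → ℂ`. -/
def solutionSpace (U : Set E) (A : Fin (n + 1) → E → ℂ) : Submodule ℂ (E → ℂ) where
  carrier := {g | Continuous g ∧ ∀ x, ∀ h ∈ U, ∑ k, A k h * g (x + ((k : ℕ) : ℝ) • h) = 0}
  add_mem' := by
    rintro f g ⟨hf, hf'⟩ ⟨hg, hg'⟩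
    refine ⟨hf.add hg, fun x h hh => ?_⟩
    simp only [Pi.add_apply, mul_add, Finset.sum_add_distrib, hf' x h hh, hg' x h hh, add_zero]
  zero_mem' := ⟨continuous_const, by simp⟩
  smul_mem' := by
    rintro c g ⟨hg, hg'⟩
    refine ⟨hg.const_smul c, fun x h hh => ?_⟩
    simp only [Pi.smul_apply, smul_eq_mul, mul_left_comm _ c, ← Finset.mul_sum, hg' x h hh,
      mul_zero]

variable {U : Set E} {A : Fin (n + 1) → E → ℂ}

theorem comp_add_right_mem_solutionSpace {g : E → ℂ} (hg : g ∈ solutionSpace U A) (v : E) :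
    (fun x => g (x + v)) ∈ solutionSpace U A := by
  refine ⟨hg.1.comp (continuous_add_const v), fun x h hh => ?_⟩
  rw [← hg.2 (x + v) h hh]
  simp only [add_right_comm]

variable [FiniteDimensional ℝ E]

theorem exists_basis_mem_of_isOpen {W : Set E} (hW : IsOpen W) (hne : W.Nonempty) :
    ∃ b : Module.Basis (Fin (Module.finrank ℝ E)) ℝ E, ∀ i, b i ∈ W := by
  have hspan : Submodule.span ℝ W = ⊤ := Submodule.eq_top_of_nonempty_interior' _
    (hne.mono (interior_maximal Submodule.subset_span hW))
  let b := Module.Basis.ofSpan hspan.ge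
  have := FiniteDimensional.fintypeBasisIndex b
  refine ⟨b.reindex (Fintype.equivFinOfCardEq (Module.finrank_eq_card_basis b).symm), fun i => ?_⟩
  rw [Module.Basis.reindex_apply]
  exact Module.Basis.ofSpan_subset hspan.ge (mem_range_self _)

variable [MeasurableSpace E] [BorelSpace E] (μ : Measure E) [μ.IsAddHaarMeasure]

/-- Multiplying the equation by a weight concentrated near a step `h` with `A k h ≠ 0` and
integrating in `h` expresses every solution through averages of itself with continuous compactly
supported weights. -/
theorem exists_average_eq (hU : IsOpen U) (hA : ∀ k, ContinuousOn (A k) U) {h₀ : E} (hh₀ : h₀ ∈ U)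
    {k : Fin (n + 1)} (hk : A k h₀ ≠ 0) :
    ∃ (c : ℂ) (ψ : Fin (n + 1) → E → ℂ), c ≠ 0 ∧ (∀ j, Continuous (ψ j)) ∧
      (∀ j, HasCompactSupport (ψ j)) ∧ ∀ g ∈ solutionSpace U A, ∀ x,
        c * g x = -∑ j ∈ Finset.univ.erase k,
          ∫ h, ψ j h * g (x + (((j : ℕ) : ℝ) - (k : ℕ)) • h) ∂μ := by
  obtain ⟨χ, hχU, hχs, hχc, hχI, hχ1⟩ := exists_contDiff_tsupport_subset (n := 0) (hU.mem_nhds hh₀)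
  -- The factor `conj (A k h)` makes the weight `ψ k` nonnegative, so its integral cannot vanish.
  let ψ : Fin (n + 1) → E → ℂ := fun j h => χ h * (starRingEnd ℂ (A k h) * A j h)
  have hχ0 : ∀ h, h ∉ U → χ h = 0 := fun h hh => image_eq_zero_of_notMem_tsupport
    fun hh' => hh (hχU hh')
  have hcs : HasCompactSupport fun h => (χ h : ℂ) := hχs.comp_left Complex.ofReal_zero
  have hψs : ∀ j, HasCompactSupport (ψ j) := fun j => hcs.mul_right
  have hψc : ∀ j, Continuous (ψ j) := fun j => by
    have h1 : ContinuousOn (ψ j) U :=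
      ((Complex.continuous_ofReal.comp hχc.continuous).continuousOn).mul
      ((Complex.continuous_conj.comp_continuousOn (hA k)).mul (hA j))
    refine h1.continuous_of_tsupport_subset hU ((closure_mono fun h hh => ?_).trans hχU)
    rw [Function.mem_support] at hh ⊢
    intro h0
    exact hh (by simp [ψ, h0])
  have hψk : ψ k = fun h => ((χ h * ‖A k h‖ ^ 2 : ℝ) : ℂ) := by
    ext h
    simp only [ψ, Complex.conj_mul']
    push_cast
    rfl
  refine ⟨∫ h, ψ k h ∂μ, ψ, ?_, hψc, hψs, fun g hg x => ?_⟩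
  · have hre : (fun h => χ h * ‖A k h‖ ^ 2) = fun h => (ψ k h).re := by
      ext h
      rw [hψk, Complex.ofReal_re]
    have hpos : 0 < ∫ h, χ h * ‖A k h‖ ^ 2 ∂μ := by
      refine Continuous.integral_pos_of_hasCompactSupport_nonneg_nonzero (x := h₀) ?_ ?_ ?_ ?_
      · rw [hre]
        exact Complex.continuous_re.comp (hψc k)
      · exact hχs.mul_right
      · exact fun h => mul_nonneg (hχI (mem_range_self h)).1 (by positivity)
      · simpa [hχ1] using hk
    rw [hψk, integral_complex_ofReal]
    exact_mod_cast hpos.ne'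
  · have hint : ∀ j, Integrable
        (fun h => ψ j h * g (x + (((j : ℕ) : ℝ) - (k : ℕ)) • h)) μ := fun j => by
      have := hg.1
      have := hψc j
      exact Continuous.integrable_of_hasCompactSupport (by fun_prop) (hψs j).mul_right
    have hsum : ∑ j, ∫ h, ψ j h * g (x + (((j : ℕ) : ℝ) - (k : ℕ)) • h) ∂μ = 0 := by
      rw [← integral_finsetSum _ fun j _ => hint j]
      refine integral_eq_zero_of_ae (Eventually.of_forall fun h => ?_)
      -- The equation at the base point `x - k • h` centres the `k`-th term at `x`.
      by_cases hh : h ∈ U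
      · have : ∑ j, A j h * g (x + (((j : ℕ) : ℝ) - (k : ℕ)) • h) = 0 := by
          rw [← hg.2 (x - ((k : ℕ) : ℝ) • h) h hh]
          refine Finset.sum_congr rfl fun j _ => ?_
          congr 2
          module
        simp only [ψ, mul_assoc, ← Finset.mul_sum, this, mul_zero, Pi.zero_apply]
      · simp [ψ, hχ0 h hh]
    rw [← Finset.add_sum_erase _ _ (Finset.mem_univ k)] at hsum
    simp only [sub_self, zero_smul, add_zero] at hsum
    rw [integral_mul_const] at hsum
    exact eq_neg_of_add_eq_zero_left hsum

include μ in
/-- The solution space is finite-dimensional: by extrapolation and equicontinuity, a solution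
vanishing on a sufficiently fine finite net of a fixed ball has its supremum on that ball bounded by
half of itself, hence vanishes identically. -/
theorem finiteDimensional_solutionSpace (hU : IsOpen U) (hA : ∀ k, ContinuousOn (A k) U)
    (hne : ∃ h ∈ U, ∃ k, A k h ≠ 0) : FiniteDimensional ℂ (solutionSpace U A) := by
  obtain ⟨h₀, hh₀, k, hk⟩ := hne
  obtain ⟨b, hb⟩ := exists_basis_mem_of_isOpen
    ((hA k).isOpen_inter_preimage hU isOpen_compl_singleton) ⟨h₀, hh₀, hk⟩
  obtain ⟨R₀, hR₀, hext⟩ := exists_forall_norm_le_closedBall b (c := fun i j => A j (b i))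
    fun i => ⟨k, (hb i).2⟩
  obtain ⟨c, ψ, hc, hψc, hψs, havg⟩ := exists_average_eq μ hU hA hh₀ hk
  have hsne : ∀ j, j ≠ k → ((j : ℕ) : ℝ) - (k : ℕ) ≠ 0 := fun j hj => by
    rw [sub_ne_zero]
    exact_mod_cast fun h => hj (Fin.ext h)
  have hev := eventually_all.2 fun j => eventually_imp_distrib_left.2 fun hj =>
    eventually_norm_average_sub_le (μ := μ) (hψc j) (hψs j) (hsne j hj) R₀
  obtain ⟨R', hR'⟩ := hev.exists
  obtain ⟨C, hC, hCb⟩ := hext R'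
  -- With this `ε` the averages together contribute at most half of `‖c‖ * sup ‖g‖`.
  set ε : ℝ := ‖c‖ / (2 * (n + 1) * (C + 1))
  have hc' : 0 < ‖c‖ := norm_pos_iff.2 hc
  have hε : 0 < ε := by positivity
  obtain ⟨δ, hδ, hδ0⟩ := ((eventually_all.2 fun j => eventually_imp_distrib_left.2 fun hj =>
    hR' j hj ε hε).and self_mem_nhdsWithin).exists
  obtain ⟨t, -, htf, htc⟩ := (isCompact_closedBall (0 : E) R₀).finite_cover_balls hδ0
  have := htf.fintype
  let ev : solutionSpace U A →ₗ[ℂ] (t → ℂ) :=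
    { toFun := fun g y => (g : E → ℂ) y
      map_add' := fun _ _ => rfl
      map_smul' := fun _ _ => rfl }
  refine FiniteDimensional.of_injective ev ((injective_iff_map_eq_zero ev).2 fun g hg => ?_)
  obtain ⟨g, hgV⟩ := g
  have hgt : ∀ y ∈ t, g y = 0 := fun y hy => congrFun hg ⟨y, hy⟩
  obtain ⟨z, hz, hzmax⟩ := (isCompact_closedBall (0 : E) R₀).exists_isMaxOn
    ⟨0, by simpa using hR₀⟩ hgV.1.norm.continuousOn
  have hbound : ∀ x, ‖x‖ ≤ R₀ → ‖g x‖ ≤ ‖g z‖ := fun x hx => hzmax (by simpa using hx)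
  have hgR' := hCb g (fun i x => hgV.2 x _ (hb i).1) _ hbound
  have hz0 : ‖g z‖ = 0 := by
    obtain ⟨y, hy, hzy⟩ : ∃ y ∈ t, dist z y < δ := by simpa using htc hz
    have h1 : c * g z = -∑ j ∈ Finset.univ.erase k,
        ((∫ h, ψ j h * g (z + (((j : ℕ) : ℝ) - (k : ℕ)) • h) ∂μ) -
          ∫ h, ψ j h * g (y + (((j : ℕ) : ℝ) - (k : ℕ)) • h) ∂μ) := by
      have := havg g hgV y
      rw [hgt y hy, mul_zero] at this
      rw [Finset.sum_sub_distrib, neg_sub, sub_eq_add_neg, ← havg g hgV z,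
        ← neg_neg (Finset.sum _ _), ← this, neg_zero, zero_add]
    have h2 : ‖c‖ * ‖g z‖ ≤ (n + 1) * (ε * (C * ‖g z‖)) := by
      rw [← norm_mul, h1, norm_neg]
      refine (norm_sum_le_of_le _ fun j hj => hδ j (Finset.ne_of_mem_erase hj) g hgV.1
        (C * ‖g z‖) (by positivity) hgR' z y (by simpa using hz) hzy).trans ?_
      rw [Finset.sum_const, nsmul_eq_mul]
      refine mul_le_mul_of_nonneg_right ?_ (by positivity)
      have := Finset.card_le_univ (Finset.univ.erase k)
      rw [Fintype.card_fin] at this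
      exact_mod_cast this
    have h3 : (n + 1) * (ε * (C * ‖g z‖)) = ‖c‖ * ‖g z‖ / 2 * (C / (C + 1)) := by
      simp only [ε]
      field_simp
    have h4 : C / (C + 1) ≤ 1 := by
      rw [div_le_one (by positivity)]
      linarith
    have h5 : ‖c‖ * ‖g z‖ / 2 * (C / (C + 1)) ≤ ‖c‖ * ‖g z‖ / 2 * 1 := by gcongr
    have h6 : ‖c‖ * ‖g z‖ ≤ 0 := by linarith
    exact le_antisymm (nonpos_of_mul_nonpos_right h6 hc') (norm_nonneg _)
  ext x
  obtain ⟨C', -, h⟩ := hext ‖x‖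
  simpa [hz0] using h g (fun i x => hgV.2 x _ (hb i).1) _ hbound x le_rfl

end SolutionSpace

/-! ### Smoothness of solutions -/

section Smoothness

variable {E : Type*} [NormedAddCommGroup E] [NormedSpace ℝ E] {n : ℕ} {U : Set E}
  {A : Fin (n + 1) → E → ℂ} [FiniteDimensional ℝ E] [MeasurableSpace E] [BorelSpace E]
  (μ : Measure E) [μ.IsAddHaarMeasure]

theorem convolution_mem_solutionSpace {φ : E → ℝ} (hφ : Continuous φ) (hφs : HasCompactSupport φ)
    {g : E → ℂ} (hg : g ∈ solutionSpace U A) :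
    convolution φ g (ContinuousLinearMap.lsmul ℝ ℝ) μ ∈ solutionSpace U A := by
  refine ⟨hφs.continuous_convolution_left _ hφ hg.1.locallyIntegrable, fun x h hh => ?_⟩
  have hgc := hg.1
  simp only [convolution, ContinuousLinearMap.lsmul_apply, ← integral_const_mul]
  rw [← integral_finsetSum]
  · refine integral_eq_zero_of_ae (Eventually.of_forall fun t => ?_)
    have := hg.2 (x - t) h hh
    simp only [mul_smul_comm, ← Finset.smul_sum, add_sub_right_comm, this, smul_zero,
      Pi.zero_apply]
  · exact fun k _ => (Continuous.integrable_of_hasCompactSupport (by fun_prop)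
      hφs.smul_right).const_mul _

include μ in
/-- A finite-dimensional space of solutions is closed under pointwise limits, and every solution is
the pointwise limit of its mollifications, which are smooth solutions. -/
theorem contDiff_of_mem_solutionSpace [FiniteDimensional ℂ (solutionSpace U A)] {g : E → ℂ}
    (hg : g ∈ solutionSpace U A) : ContDiff ℝ ∞ g := by
  let S : Submodule ℂ (E → ℂ) :=
    { carrier := {g | g ∈ solutionSpace U A ∧ ContDiff ℝ ∞ g}
      add_mem' := fun hf hg => ⟨add_mem hf.1 hg.1, hf.2.add hg.2⟩
      zero_mem' := ⟨zero_mem _, contDiff_const⟩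
      smul_mem' := fun c _ hg => ⟨Submodule.smul_mem _ c hg.1, hg.2.const_smul c⟩ }
  have : FiniteDimensional ℂ S :=
    Submodule.finiteDimensional_of_le (S₂ := solutionSpace U A) fun _ h => h.1
  have hS : IsClosed (S : Set (E → ℂ)) := S.closed_of_finiteDimensional
  let φ : ℕ → ContDiffBump (0 : E) := fun m =>
    { rIn := 1 / (m + 2)
      rOut := 1 / (m + 1)
      rIn_pos := by positivity
      rIn_lt_rOut := by
        apply one_div_lt_one_div_of_lt <;> linarith [Nat.cast_nonneg (α := ℝ) m] }
  refine (hS.mem_of_tendsto (b := atTop)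
    (f := fun m => convolution ((φ m).normed μ) g (ContinuousLinearMap.lsmul ℝ ℝ) μ)
    (tendsto_pi_nhds.2 fun x => ContDiffBump.convolution_tendsto_right_of_continuous
      tendsto_one_div_add_atTop_nhds_zero_nat hg.1 x) (Eventually.of_forall fun m => ?_)).2
  exact ⟨convolution_mem_solutionSpace μ (φ m).continuous_normed (φ m).hasCompactSupport_normed hg,
    (φ m).hasCompactSupport_normed.contDiff_convolution_left _ (φ m).contDiff_normed
      hg.1.locallyIntegrable⟩

end Smoothness

/-! ### Directional derivatives on translation-invariant spaces -/

section DirectionalDerivative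

variable {E : Type*} [NormedAddCommGroup E] [NormedSpace ℝ E] {V : Submodule ℂ (E → ℂ)}

/-- Directional derivatives are pointwise limits of difference quotients, and a finite-dimensional
subspace of `E → ℂ` is closed in the product topology. -/
theorem fderiv_apply_mem_of_translation_invariant [FiniteDimensional ℂ V]
    (hV : ∀ g ∈ V, ∀ v, (fun x => g (x + v)) ∈ V) (hs : ∀ g ∈ V, ContDiff ℝ ∞ g) {g : E → ℂ}
    (hg : g ∈ V) (v : E) : (fun x => fderiv ℝ g x v) ∈ V := by
  refine V.closed_of_finiteDimensional.mem_of_tendsto (b := atTop)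
    (f := fun c : ℝ => fun x => c • (g (x + c⁻¹ • v) - g x)) (tendsto_pi_nhds.2 fun x =>
      (((hs g hg).differentiable (by simp)) x).hasFDerivAt.lim_real v)
    (Eventually.of_forall fun c => ?_)
  exact V.smul_mem (c : ℂ) (V.sub_mem (hV g hg (c⁻¹ • v)) hg)

/-- The derivative in direction `v` as an endomorphism of a finite-dimensional translation-invariant
space of smooth functions. -/
noncomputable def directionalDerivative [FiniteDimensional ℂ V]
    (hV : ∀ g ∈ V, ∀ v, (fun x => g (x + v)) ∈ V) (hs : ∀ g ∈ V, ContDiff ℝ ∞ g) (v : E) :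
    Module.End ℂ V where
  toFun g := ⟨fun x => fderiv ℝ (g : E → ℂ) x v,
    fderiv_apply_mem_of_translation_invariant hV hs g.2 v⟩
  map_add' f g := by
    ext x
    have hf := (hs f f.2).differentiable (by simp) x
    have hg := (hs g g.2).differentiable (by simp) x
    simp [fderiv_add hf hg]
  map_smul' c g := by
    ext x
    have hg := (hs g g.2).differentiable (by simp) x
    simp [fderiv_const_smul hg c]

variable [FiniteDimensional ℂ V] (hV : ∀ g ∈ V, ∀ v, (fun x => g (x + v)) ∈ V)
  (hs : ∀ g ∈ V, ContDiff ℝ ∞ g)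

theorem directionalDerivative_apply (v : E) (g : V) (x : E) :
    (directionalDerivative hV hs v g : E → ℂ) x = fderiv ℝ (g : E → ℂ) x v := rfl

theorem commute_directionalDerivative (v w : E) :
    Commute (directionalDerivative hV hs v) (directionalDerivative hV hs w) := by
  have key : ∀ (g : V) (v w x : E),
      fderiv ℝ (fun y => fderiv ℝ (g : E → ℂ) y w) x v = fderiv ℝ (fderiv ℝ (g : E → ℂ)) x v w := by
    intro g v w x
    have h : DifferentiableAt ℝ (fderiv ℝ (g : E → ℂ)) x :=
      ((hs g g.2).fderiv_right (m := ∞) (by simp)).differentiable (by simp) x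
    rw [fderiv_clm_apply h (differentiableAt_const w)]
    simp
  ext g x
  change fderiv ℝ (fun y => fderiv ℝ (g : E → ℂ) y w) x v =
    fderiv ℝ (fun y => fderiv ℝ (g : E → ℂ) y v) x w
  rw [key, key]
  refine ((hs g g.2).contDiffAt.isSymmSndFDerivAt ?_).eq v w
  rw [minSmoothness_of_isRCLikeNormedField]
  exact WithTop.coe_le_coe.2 le_top

theorem directionalDerivative_sum_smul {ι : Type*} (s : Finset ι) (c : ι → ℝ) (v : ι → E) :
    directionalDerivative hV hs (∑ i ∈ s, c i • v i) =
      ∑ i ∈ s, (c i : ℂ) • directionalDerivative hV hs (v i) := by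
  ext g x
  simp [directionalDerivative_apply, LinearMap.sum_apply]

/-- If each function of a sequence is the derivative of the preceding one and the `K`-th is zero,
the first is its Taylor polynomial at `0`. -/
theorem eq_sum_of_hasDerivAt_succ {K : ℕ} {h : ℕ → ℝ → ℂ}
    (hd : ∀ k t, HasDerivAt (h k) (h (k + 1) t) t) (hK : ∀ t, h K t = 0) (t : ℝ) :
    h 0 t = ∑ k ∈ Finset.range K, (t : ℂ) ^ k / (k.factorial : ℂ) * h k 0 := by
  induction K generalizing h t with
  | zero => simpa using hK t
  | succ K ih =>
    have ih' := ih (h := fun k => h (k + 1)) (fun k => hd (k + 1)) hK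
    have hder : ∀ s : ℝ, HasDerivAt (fun s : ℝ => h 0 s -
        ∑ k ∈ Finset.range K, (s : ℂ) ^ (k + 1) / ((k + 1).factorial : ℂ) * h (k + 1) 0) 0 s := by
      intro s
      have h1 : ∀ k : ℕ, HasDerivAt
          (fun s : ℝ => (s : ℂ) ^ (k + 1) / ((k + 1).factorial : ℂ) * h (k + 1) 0)
          ((s : ℂ) ^ k / (k.factorial : ℂ) * h (k + 1) 0) s := by
        intro k
        have := (((hasDerivAt_pow (k + 1) (s : ℂ)).comp_ofReal).div_const
          ((k + 1).factorial : ℂ)).mul_const (h (k + 1) 0)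
        refine this.congr_deriv ?_
        have h2 : (k.factorial : ℂ) ≠ 0 := by exact_mod_cast k.factorial_ne_zero
        have h3 : (k : ℂ) + 1 ≠ 0 := by exact_mod_cast k.succ_ne_zero
        rw [Nat.factorial_succ]
        push_cast
        field_simp
      have := (hd 0 s).sub (HasDerivAt.fun_sum fun k (_ : k ∈ Finset.range K) => h1 k)
      rwa [← ih' s, sub_self] at this
    have hconst := is_const_of_deriv_eq_zero (fun s => (hder s).differentiableAt)
      (fun s => (hder s).deriv) t 0
    rw [Finset.sum_range_succ']
    simp only [Complex.ofReal_zero, ne_eq, Nat.add_eq_zero_iff, one_ne_zero, and_false,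
      not_false_eq_true, zero_pow, zero_div, zero_mul, Finset.sum_const_zero, sub_zero] at hconst
    rw [sub_eq_iff_eq_add] at hconst
    simp [hconst, add_comm]

/-- Taylor's formula along the segment from `0` to `x`, applied to `t ↦ exp (-c t) * g (t • x)`: it
is exact because iterating `∂ₓ - c` annihilates `g`. -/
theorem apply_eq_exp_mul_sum {g : V} {x : E} {c : ℂ} {K : ℕ}
    (hg : ((directionalDerivative hV hs x - algebraMap ℂ (Module.End ℂ V) c) ^ K) g = 0) :
    (g : E → ℂ) x = Complex.exp c * ∑ k ∈ Finset.range K, (k.factorial : ℂ)⁻¹ *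
      (((directionalDerivative hV hs x - algebraMap ℂ (Module.End ℂ V) c) ^ k) g : E → ℂ) 0 := by
  set N := directionalDerivative hV hs x - algebraMap ℂ (Module.End ℂ V) c
  have hd : ∀ (u : V) (t : ℝ), HasDerivAt
      (fun t : ℝ => Complex.exp (-(c * t)) * (u : E → ℂ) (t • x))
      (Complex.exp (-(c * t)) * (N u : E → ℂ) (t • x)) t := by
    intro u t
    have h1 : HasDerivAt (fun t : ℝ => (u : E → ℂ) (t • x)) (fderiv ℝ (u : E → ℂ) (t • x) x) t := by
      have := ((hs u u.2).differentiable (by simp) (t • x)).hasFDerivAt.comp_hasDerivAt t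
        ((hasDerivAt_id t).smul_const x)
      exact this.congr_deriv (by simp)
    have h2 : HasDerivAt (fun t : ℝ => Complex.exp (-(c * t))) (Complex.exp (-(c * t)) * -c) t := by
      have := (((hasDerivAt_id (t : ℂ)).const_mul c).neg.cexp).comp_ofReal
      simpa using this
    refine (h2.mul h1).congr_deriv ?_
    have h3 : (N u : E → ℂ) (t • x) = fderiv ℝ (u : E → ℂ) (t • x) x - c * (u : E → ℂ) (t • x) := by
      simp [N, directionalDerivative_apply]
    rw [h3]
    ring
  have := eq_sum_of_hasDerivAt_succ (K := K)
    (h := fun k t => Complex.exp (-(c * t)) * ((N ^ k) g : E → ℂ) (t • x))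
    (fun k t => by simpa only [pow_succ', Module.End.mul_apply] using hd ((N ^ k) g) t)
    (fun t => by simp [hg]) 1
  simp only [Complex.ofReal_one, mul_one, pow_zero, Module.End.one_apply, one_smul, one_pow,
    Complex.ofReal_zero, mul_zero, neg_zero, Complex.exp_zero, one_mul, zero_smul, one_div] at this
  rw [← this, ← mul_assoc, ← Complex.exp_add, add_neg_cancel, Complex.exp_zero, one_mul]

end DirectionalDerivative

theorem Module.End.mem_maxGenEigenspace_sum_smul {M ι : Type*} [AddCommGroup M] [Module ℂ M]
    {D : ι → Module.End ℂ M} (hD : ∀ i j, Commute (D i) (D j)) {χ : ι → ℂ} {u : M}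
    (hu : ∀ i, u ∈ (D i).maxGenEigenspace (χ i)) (c : ι → ℂ) (s : Finset ι) :
    u ∈ (∑ i ∈ s, c i • D i).maxGenEigenspace (∑ i ∈ s, c i * χ i) := by
  classical
  induction s using Finset.induction_on with
  | empty => exact (Module.End.mem_maxGenEigenspace _ _ _).2 ⟨1, by simp⟩
  | insert i s hi ih =>
    rw [Finset.sum_insert hi, Finset.sum_insert hi]
    have h1 : u ∈ (c i • D i).maxGenEigenspace (c i * χ i) :=
      Module.End.genEigenspace_le_smul (D i) (χ i) (c i) ⊤ (hu i)
    have hcomm : Commute (c i • D i) (∑ j ∈ s, c j • D j) :=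
      Commute.sum_right _ _ _ fun j _ => ((hD i j).smul_left _).smul_right _
    have := Module.End.genEigenspace_inf_le_add _ _ _ _ ⊤ ⊤ hcomm ⟨h1, ih⟩
    rwa [top_add] at this

/-! ### Exponential polynomials -/

section ExponentialPolynomials

variable {d : ℕ}

theorem IsExponentialPolynomial.coord_mul {g : EuclideanSpace ℝ (Fin d) → ℂ}
    (hg : IsExponentialPolynomial g) (i : Fin d) :
    IsExponentialPolynomial fun x => (x i : ℂ) * g x := by
  unfold IsExponentialPolynomial at hg
  induction hg using Submodule.span_induction with
  | mem g hg =>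
    obtain ⟨⟨α, l⟩, rfl⟩ := hg
    refine Submodule.subset_span ⟨(α + Pi.single i 1, l), ?_⟩
    ext x
    simp only [expMonomial, Pi.add_apply, pow_add, Finset.prod_mul_distrib]
    have : ∏ j, (x j : ℂ) ^ (Pi.single i 1 : Fin d → ℕ) j = x i := by
      rw [Finset.prod_eq_single i (fun j _ hj => by simp [hj]) (by simp)]
      simp
    rw [this]
    ring
  | zero => 
    simp only [Pi.zero_apply, mul_zero]
    exact Submodule.zero_mem _
  | add f g _ _ hf hg => 
    simp only [Pi.add_apply, mul_add]
    exact Submodule.add_mem _ hf hg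
  | smul c g _ hg =>
    simp only [Pi.smul_apply, smul_eq_mul, mul_left_comm _ c]
    exact Submodule.smul_mem _ c hg

theorem isExponentialPolynomial_finset_sum {ι : Type*} (s : Finset ι)
    {g : ι → EuclideanSpace ℝ (Fin d) → ℂ} (hg : ∀ i ∈ s, IsExponentialPolynomial (g i)) :
    IsExponentialPolynomial fun x => ∑ i ∈ s, g i x := by
  have := Submodule.sum_mem _ hg
  unfold IsExponentialPolynomial
  convert this using 1
  ext x
  simp

/-- Applying a linear functional `ℓ` to `(∑ i, x i • N i) ^ k` at a vector gives a polynomial in the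
coordinates of `x`, so its product with `exp ⟨x, χ⟩` is an exponential polynomial. -/
theorem isExponentialPolynomial_exp_mul_pow {M : Type*} [AddCommGroup M] [Module ℂ M]
    (N : Fin d → Module.End ℂ M) (χ : Fin d → ℂ) (ℓ : M →ₗ[ℂ] ℂ) (k : ℕ) (u : M) :
    IsExponentialPolynomial fun x =>
      Complex.exp (∑ i, (x i : ℂ) * χ i) * ℓ (((∑ i, (x i : ℂ) • N i) ^ k) u) := by
  induction k generalizing u with
  | zero =>
    have : expMonomial 0 χ ∈ Submodule.span ℂ
        (range fun p : (Fin d → ℕ) × (Fin d → ℂ) => expMonomial p.1 p.2) :=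
      Submodule.subset_span ⟨(0, χ), rfl⟩
    have heq : (fun x : EuclideanSpace ℝ (Fin d) =>
        Complex.exp (∑ i, (x i : ℂ) * χ i) * ℓ (((∑ i, (x i : ℂ) • N i) ^ 0) u)) =
          ℓ u • expMonomial 0 χ := by
      ext x
      simp [expMonomial, mul_comm]
    rw [heq]
    exact Submodule.smul_mem _ (ℓ u) this
  | succ k ih =>
    convert isExponentialPolynomial_finset_sum Finset.univ
      (fun i _ => (ih (N i u)).coord_mul i) using 2 with x
    simp only [pow_succ, Module.End.mul_apply, LinearMap.sum_apply, LinearMap.smul_apply, map_sum,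
      map_smul, smul_eq_mul, Finset.mul_sum]
    exact Finset.sum_congr rfl fun i _ => by ring

/-- The members of a finite-dimensional translation-invariant space of smooth functions are
exponential polynomials. On a joint generalized eigenspace of the partial derivatives, with
eigenvalues `χ`, the exact Taylor formula writes a member as `exp ⟨x, χ⟩` times a polynomial. -/
theorem isExponentialPolynomial_of_translation_invariant
    {V : Submodule ℂ (EuclideanSpace ℝ (Fin d) → ℂ)} [FiniteDimensional ℂ V]
    (hV : ∀ g ∈ V, ∀ v, (fun x => g (x + v)) ∈ V) (hs : ∀ g ∈ V, ContDiff ℝ ∞ g)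
    {g : EuclideanSpace ℝ (Fin d) → ℂ} (hg : g ∈ V) : IsExponentialPolynomial g := by
  let D : Fin d → Module.End ℂ V := fun i =>
    directionalDerivative hV hs (EuclideanSpace.single i 1)
  have hD : ∀ i j, Commute (D i) (D j) := fun i j => commute_directionalDerivative hV hs _ _
  have hx : ∀ x : EuclideanSpace ℝ (Fin d),
      directionalDerivative hV hs x = ∑ i, (x i : ℂ) • D i := fun x => by
    rw [← directionalDerivative_sum_smul]
    congr 1
    ext j
    simp [Finset.sum_apply, Pi.single_apply]
  have htop :=
    Module.End.iSup_iInf_maxGenEigenspace_eq_top_of_iSup_maxGenEigenspace_eq_top_of_commute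
    D (fun i j _ => hD i j) fun i => Module.End.iSup_maxGenEigenspace_eq_top (D i)
  have hmem : (⟨g, hg⟩ : V) ∈ ⨆ χ : Fin d → ℂ, ⨅ i, (D i).maxGenEigenspace (χ i) :=
    htop ▸ Submodule.mem_top
  suffices H : ∀ u : V, u ∈ ⨆ χ : Fin d → ℂ, ⨅ i, (D i).maxGenEigenspace (χ i) →
      IsExponentialPolynomial (u : EuclideanSpace ℝ (Fin d) → ℂ) from H _ hmem
  intro u hu
  induction hu using Submodule.iSup_induction' with
  | zero => exact Submodule.zero_mem _
  | add u v _ _ hu hv => exact Submodule.add_mem _ hu hv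
  | mem χ u hu =>
    rw [Submodule.mem_iInf] at hu
    let N : Fin d → Module.End ℂ V := fun i => D i - algebraMap ℂ _ (χ i)
    let ℓ : V →ₗ[ℂ] ℂ := (LinearMap.proj 0).comp V.subtype
    have hN : ∀ x : EuclideanSpace ℝ (Fin d), directionalDerivative hV hs x -
        algebraMap ℂ (Module.End ℂ V) (∑ i, (x i : ℂ) * χ i) = ∑ i, (x i : ℂ) • N i := fun x => by
      refine LinearMap.ext fun w => ?_
      simp only [hx, N, LinearMap.sub_apply, LinearMap.sum_apply, LinearMap.smul_apply,
        Module.algebraMap_end_apply, smul_sub, Finset.sum_sub_distrib, Finset.sum_smul, mul_smul]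
    have hnil : ∀ x : EuclideanSpace ℝ (Fin d),
        ((directionalDerivative hV hs x - algebraMap ℂ (Module.End ℂ V)
          (∑ i, (x i : ℂ) * χ i)) ^ Module.finrank ℂ V) u = 0 := fun x => by
      have := Module.End.mem_maxGenEigenspace_sum_smul hD hu (fun i => (x i : ℂ)) Finset.univ
      rw [← hx, Module.End.maxGenEigenspace_eq_genEigenspace_finrank,
        Module.End.mem_genEigenspace_nat] at this
      rwa [Algebra.algebraMap_eq_smul_one]
    convert isExponentialPolynomial_finset_sum (Finset.range (Module.finrank ℂ V)) fun k _ =>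
      Submodule.smul_mem _ ((k.factorial : ℂ)⁻¹)
        (isExponentialPolynomial_exp_mul_pow N χ ℓ k u) using 2 with x
    rw [apply_eq_exp_mul_sum hV hs (hnil x), Finset.mul_sum]
    refine Finset.sum_congr rfl fun k _ => ?_
    rw [hN, mul_left_comm]
    rfl

end ExponentialPolynomials

theorem corollary2p3 (d n : ℕ) (f : EuclideanSpace ℝ (Fin d) → ℝ) (hf : Continuous f)
    (U : Set (EuclideanSpace ℝ (Fin d))) (hU : IsOpen U)
    (a : Fin (n + 1) → EuclideanSpace ℝ (Fin d) → ℝ) (ha : ∀ k, ContinuousOn (a k) U)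
    (ha_ne : ∃ h ∈ U, ∃ k, a k h ≠ 0)
    (heq : ∀ x : EuclideanSpace ℝ (Fin d), ∀ h ∈ U,
      ∑ k : Fin (n + 1), a k h * f (x + (k : ℕ) • h) = 0) :
    IsExponentialPolynomial (fun x => (f x : ℂ)) := by
  have := finiteDimensional_solutionSpace (U := U) (A := fun k h => (a k h : ℂ)) volume hU
    (fun k => Complex.continuous_ofReal.comp_continuousOn (ha k)) (by simpa using ha_ne)
  refine isExponentialPolynomial_of_translation_invariant
    (V := solutionSpace U fun k h => (a k h : ℂ))
    (fun g hg v => comp_add_right_mem_solutionSpace hg v)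
    (fun g hg => contDiff_of_mem_solutionSpace volume hg)
    ⟨Complex.continuous_ofReal.comp hf, fun x h hh => ?_⟩
  simp only [Nat.cast_smul_eq_nsmul]
  exact_mod_cast heq x h hh
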